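/- Let $\mathcal A$ be a complex unital Banach algebra. An element is quasinilpotent if its spectral radius is $0$. For $a\in\mathcal A$, the generalized Drazin inverse $a^d$ is the (unique, if it exists) element with $a^daa^d=a^d$, $aa^d=a^da$ and $a-a^2a^d$ quasinilpotent; $\mathcal A^d$ is the set of elements that have one, and $a^\pi=1-aa^d$ for $a\in\mathcal A^d$. Let $a,b\in\mathcal A^d$ satisfy $aba^\pi=a^\pi baa^\pi$ and $a^2a^db=aa^dba$, and suppose that at least one of the elements $a^\pi ba^\pi$, $a^\pi b$, $ba^\pi$, $aa^dbaa^d$, $aa^db$, $baa^d$ belongs to $\mathcal A^d$. Then $$a+b\in\mathcal A^d\iff 1+a^db\in\mathcal A^d\iff aa^d(1+a^db)\in\mathcal A^d\iff(1+a^db)aa^d\in\mathcal A^d\iff aa^d(1+a^db)aa^d\in\mathcal A^d.$$ In this case $c=aa^d(a+b)$ belongs to $\mathcal A^d$, $$c^d=a^d(1+a^db)^dbb^d+aa^d\sum_{n=0}^\infty b^\pi(-b)^n(a^d)^{n+1},$$ and $$\begin{aligned}(a+b)^d={}&c^d+\sum_{n=0}^\infty(b^d)^{n+1}(-a)^na^\pi-\sum_{n=0}^\infty(b^d)^{n+1}(-a)^na^\pi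 bc^d\\&+\sum_{n=0}^\infty\Big(\sum_{k=0}^\infty(b^d)^{k+1}(-a)^ka^\pi\Big)^{n+2}baa^dc^nc^\pi\\&+\sum_{n=0}^\infty\Big((a+b)^na^\pi b(c^d)^{n+2}-\sum_{k=0}^\infty(b^d)^{k+1}(-a)^ka^\pi(a+b)^{n+1}a^\pi b(c^d)^{n+2}\Big),\end{aligned}$$ where all the series (the inner series over $k$, and the outer series over $n$ with the displayed terms) converge unconditionally. -/

import Mathlib

open Filter Topology

section GeneralizedDrazin

variable {A : Type*} [NormedRing A] [NormedAlgebra ℂ A]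

/-- An element is quasinilpotent if its spectral radius is zero. -/
def IsQuasinilpotent (x : A) : Prop := spectralRadius ℂ x = 0

/-- `x` is a generalized Drazin (Koliha--Drazin) inverse of `a`:
`x a x = x`, `a x = x a`, and `a - a² x` is quasinilpotent. -/
structure IsGDrazinInverse (a x : A) : Prop where
  outer : x * a * x = x
  comm : a * x = x * a
  qnil : IsQuasinilpotent (a - a ^ 2 * x)

/-- The set of generalized Drazin invertible elements. -/
def IsGDrazinInvertible (a : A) : Prop := ∃ x, IsGDrazinInverse a x

open Classical in
/-- The generalized Drazin inverse (with value `0` if there is none). -/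
noncomputable def gDrazinInv (a : A) : A :=
  if h : IsGDrazinInvertible a then h.choose else 0

postfix:max "ᵈ" => gDrazinInv

/-- The spectral idempotent `1 - a aᵈ` of `a` at `0`. -/
noncomputable def specIdem (a : A) : A := 1 - a * aᵈ

theorem IsGDrazinInvertible.isGDrazinInverse {a : A} (h : IsGDrazinInvertible a) :
    IsGDrazinInverse a aᵈ := by
  unfold gDrazinInv
  rw [dif_pos h]
  exact h.choose_spec

theorem IsQuasinilpotent.tendsto_mul_norm_pow [CompleteSpace A] {r : A} (hr : IsQuasinilpotent r)
    (C : ℝ) (hC : 0 ≤ C) : Tendsto (fun n : ℕ => C ^ n * ‖r ^ n‖) atTop (𝓝 0) := by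
  have h := spectrum.pow_nnnorm_pow_one_div_tendsto_nhds_spectralRadius r
  rw [show spectralRadius ℂ r = 0 from hr] at h
  set e : ℝ := 1 / (2 * (C + 1)) with he
  have hepos : 0 < e := by positivity
  have h1 := h.eventually (gt_mem_nhds (ENNReal.ofReal_pos.mpr hepos))
  have h2 : ∀ᶠ n : ℕ in atTop, C ^ n * ‖r ^ n‖ ≤ (1 / 2 : ℝ) ^ n := by
    filter_upwards [h1, eventually_gt_atTop 0] with n hn hn0
    have hnR : (0 : ℝ) < n := by exact_mod_cast hn0
    have h3 : (‖r ^ n‖₊ : ENNReal) ≤ (ENNReal.ofReal e) ^ n := by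
      have := ENNReal.rpow_le_rpow hn.le hnR.le
      rwa [← ENNReal.rpow_mul, one_div_mul_cancel hnR.ne', ENNReal.rpow_one,
        ENNReal.rpow_natCast] at this
    have h4 : ‖r ^ n‖ ≤ e ^ n := by
      rw [← ENNReal.ofReal_pow hepos.le] at h3
      have h5 := ENNReal.toReal_mono ENNReal.ofReal_ne_top h3
      rw [ENNReal.toReal_ofReal (by positivity)] at h5
      simpa using h5
    calc C ^ n * ‖r ^ n‖ ≤ C ^ n * e ^ n := by gcongr
      _ = (C * e) ^ n := (mul_pow _ _ _).symm
      _ ≤ (1 / 2 : ℝ) ^ n := by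
        gcongr
        rw [he, mul_one_div, div_le_div_iff₀ (by positivity) (by norm_num)]
        linarith
  exact squeeze_zero' (Eventually.of_forall fun n => by positivity) h2
    (tendsto_pow_atTop_nhds_zero_of_lt_one (by norm_num) (by norm_num))

/-- The generalized Drazin inverse is unique. -/
theorem IsGDrazinInverse.unique [CompleteSpace A] {a x y : A}
    (hx : IsGDrazinInverse a x) (hy : IsGDrazinInverse a y) : x = y := by
  have key : ∀ z : A, ∀ u : A, IsQuasinilpotent u → ∀ w : A,
      (∀ n : ℕ, 0 < n → ‖w‖ ≤ ‖z ^ n‖ * ‖u ^ n‖) → w = 0 := by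
    intro z u hu w hw
    have ht := hu.tendsto_mul_norm_pow ‖z‖ (norm_nonneg z)
    have : ‖w‖ ≤ 0 := by
      refine ge_of_tendsto ht ?_
      filter_upwards [eventually_gt_atTop 0] with n hn
      exact (hw n hn).trans
        (mul_le_mul_of_nonneg_right (norm_pow_le' z hn) (norm_nonneg _))
    simpa using this
  have pw : ∀ z : A, IsGDrazinInverse a z → ∀ n : ℕ, 0 < n →
      z ^ n * a ^ n = a * z ∧ a ^ n * z ^ n = a * z ∧
      (a - a ^ 2 * z) ^ n = a ^ n * (1 - a * z) ∧
      (a - a ^ 2 * z) ^ n = (1 - a * z) * a ^ n := by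
    intro z hz n hn
    have hc : Commute a z := hz.comm
    have hid : IsIdempotentElem (a * z) := by
      change a * z * (a * z) = a * z
      rw [mul_assoc, ← mul_assoc z, hz.outer]
    have hid' : IsIdempotentElem (1 - a * z) := hid.one_sub
    have hca : Commute a (1 - a * z) :=
      (Commute.one_right a).sub_right ((Commute.refl a).mul_right hc)
    have h1 : a ^ n * z ^ n = a * z := by
      rw [← hc.mul_pow, hid.pow_eq hn.ne']
    have h2 : (a - a ^ 2 * z) ^ n = a ^ n * (1 - a * z) := by
      have : a - a ^ 2 * z = a * (1 - a * z) := by noncomm_ring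
      rw [this, hca.mul_pow, hid'.pow_eq hn.ne']
    exact ⟨by rw [← h1, (hc.pow_pow n n).eq], h1, h2, by rw [h2, (hca.pow_left n).eq]⟩
  have e1 : a * x * (1 - a * y) = 0 := by
    refine key x _ hy.qnil _ fun n hn => ?_
    rw [← (pw x hx n hn).1, mul_assoc, ← (pw y hy n hn).2.2.1]
    exact norm_mul_le _ _
  have e2 : (1 - a * x) * (a * y) = 0 := by
    refine key y _ hx.qnil _ fun n hn => ?_
    rw [← (pw y hy n hn).2.1, ← mul_assoc, ← (pw x hx n hn).2.2.2, mul_comm ‖y ^ n‖]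
    exact norm_mul_le _ _
  have e3 : a * x = a * y := by
    rw [mul_sub, mul_one, sub_eq_zero] at e1
    rw [sub_mul, one_mul, sub_eq_zero] at e2
    rw [e1, ← e2]
  calc x = x * (a * x) := by rw [← mul_assoc, hx.outer]
    _ = (x * a) * y := by rw [e3, mul_assoc]
    _ = a * y * y := by rw [← hx.comm, e3]
    _ = y := by rw [hy.comm, hy.outer]

theorem IsGDrazinInverse.gDrazinInv_eq [CompleteSpace A] {a x : A} (h : IsGDrazinInverse a x) :
    aᵈ = x :=
  (IsGDrazinInvertible.isGDrazinInverse ⟨x, h⟩).unique h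

end GeneralizedDrazin

/-! ### Quasinilpotent elements -/

section GeneralizedDrazin

variable {A : Type*} [NormedRing A] [NormedAlgebra ℂ A]

/-! Put p = a a^d and q = 1 - p = a^π. The first hypothesis gives p b q = a^d (a b q) = a^d q b a q
= 0, so a is block diagonal with respect to p while b and a + b are block triangular; it also makes
the quasinilpotent a q commute with b q. The second hypothesis says that a commutes with p b.

Two tools carry the argument. A generalized Drazin inverse respects intertwining
(`IsGDrazinInverse.mul_eq_mul`): hence if a triangular element and one of its corners are invertible
in this sense, its inverse is triangular and the other corner is invertible too. Conversely, a
triangular z is z p + z q with (z p)(z q) = 0, and the series for a sum u + v with u v = 0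
(`IsGDrazinInverse.add_of_mul_eq_zero`), together with Cline's formula to pass from p z to z p,
inverts z from its corners (`IsGDrazinInverse.of_corners`).

Each of the six elements equals p b or b q up to Cline's swap, so b^d is triangular and b q is
invertible. The corner (a + b) q is then a commuting quasinilpotent perturbation of b q, inverted by
a Neumann-type series. So everything hinges on c = p (a + b) = a · p (1 + a^d b), a product of
commuting factors that can be undone by multiplying with a^d; and 1 + a^d b is block diagonal with
q-block q.

For c^d, the idempotent p b^π commutes with c and splits off a part on which p b is quasinilpotent:
perturbing a there gives the second summand. -/

theorem isQuasinilpotent_iff_isUnit {r : A} :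
    IsQuasinilpotent r ↔ ∀ z : ℂ, IsUnit (1 - z • r) := by
  constructor
  · intro h z
    refine spectrum.isUnit_one_sub_smul_of_lt_inv_radius ?_
    rw [show spectralRadius ℂ r = 0 from h]
    simp
  · intro h
    simp only [IsQuasinilpotent, spectralRadius, ENNReal.iSup_eq_zero]
    intro k hk
    by_contra hk0
    have hk0 : k ≠ 0 := by rintro rfl; simp at hk0
    refine hk ?_
    have h1 := (h k⁻¹).smul (Units.mk0 k hk0)
    have h2 : Units.mk0 k hk0 • (1 - k⁻¹ • r) = algebraMap ℂ A k - r := by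
      simp [Units.smul_def, smul_sub, smul_smul, hk0, Algebra.algebraMap_eq_smul_one]
    rwa [h2] at h1

theorem IsQuasinilpotent.summable_mul_norm_pow [CompleteSpace A] {r : A}
    (hr : IsQuasinilpotent r) (C : ℝ) (hC : 0 ≤ C) :
    Summable (fun n : ℕ => C ^ n * ‖r ^ n‖) := by
  -- Decay at rate 2C makes the terms at rate C eventually at most (1/2)^n.
  have h := hr.tendsto_mul_norm_pow (2 * C) (by positivity)
  have h1 : ∀ᶠ n : ℕ in atTop, (2 * C) ^ n * ‖r ^ n‖ ≤ 1 :=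
    (h.eventually (gt_mem_nhds one_pos)).mono fun _ h => h.le
  refine Summable.of_norm_bounded_eventually_nat (g := fun n : ℕ => (1 / 2 : ℝ) ^ n)
    (summable_geometric_of_lt_one (by norm_num) (by norm_num)) ?_
  filter_upwards [h1] with n hn
  rw [Real.norm_of_nonneg (by positivity), one_div, inv_pow, ← one_div,
    le_div_iff₀ (by positivity)]
  calc _ = (2 * C) ^ n * ‖r ^ n‖ := by rw [mul_pow]; ring
    _ ≤ 1 := hn

theorem isQuasinilpotent_of_summable [CompleteSpace A] {r : A}
    (h : ∀ C : ℝ, 0 ≤ C → Summable (fun n : ℕ => C ^ n * ‖r ^ n‖)) : IsQuasinilpotent r := by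
  refine isQuasinilpotent_iff_isUnit.2 fun z => ?_
  have hs : Summable (fun n : ℕ => (z • r) ^ n) := by
    refine Summable.of_norm ((h ‖z‖ (norm_nonneg _)).congr fun n => ?_)
    rw [smul_pow, norm_smul, norm_pow z]
  exact isUnit_iff_exists.2 ⟨_, hs.one_sub_mul_tsum_pow, hs.tsum_pow_mul_one_sub⟩

-- The bound is required only for n > 0, because ‖1‖ ≤ 1 is not assumed and so ‖z ^ 0‖ ≤ ‖z‖ ^ 0 may
-- fail.
omit [NormedAlgebra ℂ A] in
theorem summable_mul_norm_pow_of_le [CompleteSpace A] {r : A} {f : ℕ → A} {C K : ℝ}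
    (h : Summable (fun n : ℕ => C ^ n * ‖r ^ n‖))
    (hf : ∀ n, 0 < n → ‖f n‖ ≤ K * (C ^ n * ‖r ^ n‖)) : Summable f := by
  refine Summable.of_norm_bounded_eventually_nat (h.mul_left K) ?_
  filter_upwards [eventually_gt_atTop 0] with n hn
  exact hf n hn

/-- A series with terms `x rⁿ y zⁿ w`, where `r` is quasinilpotent, converges. -/
theorem IsQuasinilpotent.summable_mul_pow_mul [CompleteSpace A] {r : A}
    (hr : IsQuasinilpotent r) (x y z w : A) :
    Summable (fun n : ℕ => x * r ^ n * y * z ^ n * w) := by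
  refine summable_mul_norm_pow_of_le (hr.summable_mul_norm_pow _ (norm_nonneg z))
    (K := ‖x‖ * ‖y‖ * ‖w‖) fun n hn => ?_
  calc _ ≤ ‖x‖ * ‖r ^ n‖ * ‖y‖ * ‖z ^ n‖ * ‖w‖ := by
        refine (norm_mul_le _ _).trans ?_
        gcongr
        refine (norm_mul_le _ _).trans ?_
        gcongr
        refine (norm_mul_le _ _).trans ?_
        gcongr
        exact norm_mul_le _ _
    _ ≤ ‖x‖ * ‖r ^ n‖ * ‖y‖ * ‖z‖ ^ n * ‖w‖ := by
        gcongr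
        exact norm_pow_le' z hn
    _ = _ := by ring

/-- A series with terms `x zⁿ y rⁿ w`, where `r` is quasinilpotent, converges. -/
theorem IsQuasinilpotent.summable_mul_pow_mul' [CompleteSpace A] {r : A}
    (hr : IsQuasinilpotent r) (x y z w : A) :
    Summable (fun n : ℕ => x * z ^ n * y * r ^ n * w) := by
  refine summable_mul_norm_pow_of_le (hr.summable_mul_norm_pow _ (norm_nonneg z))
    (K := ‖x‖ * ‖y‖ * ‖w‖) fun n hn => ?_
  calc _ ≤ ‖x‖ * ‖z ^ n‖ * ‖y‖ * ‖r ^ n‖ * ‖w‖ := by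
        refine (norm_mul_le _ _).trans ?_
        gcongr
        refine (norm_mul_le _ _).trans ?_
        gcongr
        refine (norm_mul_le _ _).trans ?_
        gcongr
        exact norm_mul_le _ _
    _ ≤ ‖x‖ * ‖z‖ ^ n * ‖y‖ * ‖r ^ n‖ * ‖w‖ := by
        gcongr
        exact norm_pow_le' z hn
    _ = _ := by ring

theorem IsQuasinilpotent.mul_of_commute [CompleteSpace A] {r s : A} (hr : IsQuasinilpotent r)
    (h : Commute r s) : IsQuasinilpotent (r * s) := by
  refine isQuasinilpotent_of_summable fun C hC => ?_
  have hC' : 0 ≤ C * ‖s‖ := by positivity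
  refine Summable.of_norm_bounded_eventually_nat (hr.summable_mul_norm_pow _ hC') ?_
  filter_upwards [eventually_gt_atTop 0] with n hn
  rw [Real.norm_of_nonneg (by positivity), h.mul_pow]
  calc _ ≤ C ^ n * (‖r ^ n‖ * ‖s‖ ^ n) := by
        gcongr
        refine (norm_mul_le _ _).trans ?_
        gcongr
        exact norm_pow_le' s hn
    _ = _ := by rw [mul_pow]; ring

theorem isUnit_one_sub_mul_comm {R : Type*} [Ring R] {x y : R} (h : IsUnit (1 - x * y)) :
    IsUnit (1 - y * x) := by
  obtain ⟨i, h1, h2⟩ := isUnit_iff_exists.1 h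
  -- Jacobson's lemma: formally, ∑ (y x)^n = 1 + y (∑ (x y)^n) x.
  refine isUnit_iff_exists.2 ⟨1 + y * i * x, ?_, ?_⟩
  · calc _ = 1 - y * x + y * ((1 - x * y) * i) * x := by noncomm_ring
      _ = 1 := by rw [h1]; noncomm_ring
  · calc _ = 1 - y * x + y * (i * (1 - x * y)) * x := by noncomm_ring
      _ = 1 := by rw [h2]; noncomm_ring

theorem IsQuasinilpotent.mul_swap {x y : A} (h : IsQuasinilpotent (x * y)) :
    IsQuasinilpotent (y * x) := by
  rw [isQuasinilpotent_iff_isUnit] at h ⊢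
  intro z
  have := h z
  rw [← smul_mul_assoc] at this
  rw [← mul_smul_comm]
  exact isUnit_one_sub_mul_comm this

theorem IsQuasinilpotent.smul {r : A} (h : IsQuasinilpotent r) (k : ℂ) :
    IsQuasinilpotent (k • r) := by
  rw [isQuasinilpotent_iff_isUnit] at h ⊢
  intro z
  rw [smul_smul]
  exact h _

theorem IsQuasinilpotent.neg {r : A} (h : IsQuasinilpotent r) :
    IsQuasinilpotent (-r) := by
  simpa using h.smul (-1)

theorem IsQuasinilpotent.add_of_commute [CompleteSpace A] {r s : A} (hr : IsQuasinilpotent r)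
    (hs : IsQuasinilpotent s) (h : Commute r s) : IsQuasinilpotent (r + s) := by
  rw [isQuasinilpotent_iff_isUnit]
  intro z
  obtain ⟨i, hi⟩ := isQuasinilpotent_iff_isUnit.1 hr z
  have hc : Commute s (i : A) := by
    rw [hi]
    exact (Commute.one_right s).sub_right (h.symm.smul_right z)
  have h2 := isQuasinilpotent_iff_isUnit.1 (hs.mul_of_commute hc.units_inv_right) z
  -- With i = 1 - z r factored out, what remains is governed by s i⁻¹, quasinilpotent because s
  -- commutes with i.
  have h3 : 1 - z • (r + s) = (1 - z • (s * ↑i⁻¹)) * i := by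
    rw [sub_mul, one_mul, smul_mul_assoc, Units.inv_mul_cancel_right, hi, smul_add, sub_sub]
  rw [h3]
  exact h2.mul i.isUnit

theorem IsQuasinilpotent.add_of_mul_eq_zero {r s : A} (hr : IsQuasinilpotent r)
    (hs : IsQuasinilpotent s) (h : r * s = 0) : IsQuasinilpotent (r + s) := by
  rw [isQuasinilpotent_iff_isUnit]
  intro z
  have h3 : 1 - z • (r + s) = (1 - z • r) * (1 - z • s) := by
    simp only [mul_sub, sub_mul, smul_mul_smul_comm, h, smul_add, one_mul, mul_one, smul_zero]
    abel
  rw [h3]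
  exact (isQuasinilpotent_iff_isUnit.1 hr z).mul (isQuasinilpotent_iff_isUnit.1 hs z)

theorem isQuasinilpotent_zero : IsQuasinilpotent (0 : A) := by
  rw [isQuasinilpotent_iff_isUnit]
  simp

theorem mul_mul_eq_of_eq {M : Type*} [Semigroup M] {x y z : M} (h : x * y = z) (w : M) :
    x * (y * w) = z * w := by
  rw [← mul_assoc, h]

/-- The general term of a convergent series tends to 0, so it cannot be a nonzero constant from n =
1 on. -/
theorem IsQuasinilpotent.eq_zero_of_forall_eq [CompleteSpace A] {r : A} (hr : IsQuasinilpotent r)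
    {w x y z v : A} (h : ∀ n : ℕ, 0 < n → w = x * r ^ n * y * z ^ n * v) : w = 0 := by
  refine tendsto_nhds_unique (tendsto_const_nhds (f := atTop (α := ℕ)))
    ((hr.summable_mul_pow_mul x y z v).tendsto_atTop_zero.congr' ?_)
  filter_upwards [eventually_gt_atTop 0] with n hn using (h n hn).symm

theorem IsQuasinilpotent.eq_zero_of_forall_eq' [CompleteSpace A] {r : A} (hr : IsQuasinilpotent r)
    {w x y z v : A} (h : ∀ n : ℕ, 0 < n → w = x * z ^ n * y * r ^ n * v) : w = 0 := by
  refine tendsto_nhds_unique (tendsto_const_nhds (f := atTop (α := ℕ)))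
    ((hr.summable_mul_pow_mul' x y z v).tendsto_atTop_zero.congr' ?_)
  filter_upwards [eventually_gt_atTop 0] with n hn using (h n hn).symm

/-! ### Algebra of generalized Drazin inverses: intertwining, Cline's formula, commuting products -/

namespace IsGDrazinInverse

variable {a x b y : A}

theorem isIdempotentElem (h : IsGDrazinInverse a x) : IsIdempotentElem (a * x) := by
  change a * x * (a * x) = a * x
  rw [mul_assoc, ← mul_assoc x, h.outer]

theorem mul_mul_self (h : IsGDrazinInverse a x) : x * (a * x) = x := by
  rw [← mul_assoc, h.outer]

theorem mul_self_mul (h : IsGDrazinInverse a x) : a * (x * x) = x := by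
  rw [← mul_assoc, h.comm, h.outer]

theorem mul_mul_self' (h : IsGDrazinInverse a x) : x * (x * a) = x := by
  rw [← h.comm, h.mul_mul_self]

theorem pow_mul_pow (h : IsGDrazinInverse a x) {n : ℕ} (hn : 0 < n) :
    a ^ n * x ^ n = a * x := by
  have hc : Commute a x := h.comm
  rw [← hc.mul_pow, h.isIdempotentElem.pow_eq hn.ne']

theorem commute_one_sub (h : IsGDrazinInverse a x) : Commute a (1 - a * x) :=
  (Commute.one_right a).sub_right ((Commute.refl a).mul_right h.comm)

theorem pow_one_sub_mul (h : IsGDrazinInverse a x) {n : ℕ} (hn : 0 < n) :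
    ((1 - a * x) * a) ^ n = (1 - a * x) * a ^ n := by
  rw [h.commute_one_sub.symm.mul_pow, h.isIdempotentElem.one_sub.pow_eq hn.ne']

theorem pow_mul_one_sub (h : IsGDrazinInverse a x) {n : ℕ} (hn : 0 < n) :
    (a * (1 - a * x)) ^ n = a ^ n * (1 - a * x) := by
  rw [h.commute_one_sub.mul_pow, h.isIdempotentElem.one_sub.pow_eq hn.ne']

theorem isQuasinilpotent_mul_one_sub (h : IsGDrazinInverse a x) :
    IsQuasinilpotent (a * (1 - a * x)) := by
  have : a * (1 - a * x) = a - a ^ 2 * x := by noncomm_ring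
  rw [this]
  exact h.qnil

theorem isQuasinilpotent_one_sub_mul (h : IsGDrazinInverse a x) :
    IsQuasinilpotent ((1 - a * x) * a) := by
  rw [← h.commute_one_sub.eq]
  exact h.isQuasinilpotent_mul_one_sub

theorem of_isQuasinilpotent_mul_one_sub (h1 : x * (a * x) = x) (h2 : a * x = x * a)
    (h3 : IsQuasinilpotent (a * (1 - a * x))) : IsGDrazinInverse a x := by
  refine ⟨by rw [mul_assoc, h1], h2, ?_⟩
  have : a - a ^ 2 * x = a * (1 - a * x) := by noncomm_ring
  rwa [this]

/-- Generalized Drazin inverses inherit intertwining relations. -/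
theorem mul_eq_mul [CompleteSpace A] (ha : IsGDrazinInverse a x) (hb : IsGDrazinInverse b y)
    {t : A} (h : a * t = t * b) : x * t = t * y := by
  have hp : ∀ n : ℕ, a ^ n * t = t * b ^ n := fun n =>
    (SemiconjBy.pow_right (show SemiconjBy t b a from h.symm) n).eq.symm
  -- Write b y = b^n y^n and move t across: the element equals ((1 - a x) a)^n t y^n for all n > 0,
  -- whose limit is 0.
  have e1 : (1 - a * x) * t * (b * y) = 0 := by
    refine ha.isQuasinilpotent_one_sub_mul.eq_zero_of_forall_eq (x := 1) (y := t) (z := y)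
      (v := 1) fun n hn => ?_
    rw [one_mul, mul_one, ha.pow_one_sub_mul hn, ← hb.pow_mul_pow hn]
    simp only [mul_assoc, mul_mul_eq_of_eq (hp n)]
  have e2 : (a * x) * t * (1 - b * y) = 0 := by
    refine hb.isQuasinilpotent_mul_one_sub.eq_zero_of_forall_eq' (x := 1) (y := t) (z := x)
      (v := 1) fun n hn => ?_
    have hc : Commute a x := ha.comm
    rw [one_mul, mul_one, hb.pow_mul_one_sub hn, ← ha.pow_mul_pow hn, (hc.pow_pow n n).eq]
    simp only [mul_assoc, mul_mul_eq_of_eq (hp n)]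
  have e3 : a * x * t = t * (b * y) := by
    rw [sub_mul, sub_mul, one_mul, sub_eq_zero] at e1
    rw [mul_sub, mul_one, sub_eq_zero] at e2
    rw [e1, ← e2]
  calc x * t = x * (a * x * t) := by rw [← mul_assoc, ha.mul_mul_self]
    _ = x * (a * t) * y := by rw [e3, h]; simp only [mul_assoc]
    _ = (a * x * t) * y := by rw [ha.comm]; simp only [mul_assoc]
    _ = t * y := by rw [e3, mul_assoc, mul_assoc, hb.mul_self_mul]

theorem commute_of_commute [CompleteSpace A] (ha : IsGDrazinInverse a x) {t : A}
    (h : Commute a t) : Commute x t :=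
  ha.mul_eq_mul ha h.eq

/-- Cline's formula. The new remainder is a · (1 - b a y) b; exchanging the factors turns it into
the remainder of b a, and quasinilpotence survives the exchange. -/
theorem mul_swap (h : IsGDrazinInverse (b * a) y) : IsGDrazinInverse (a * b) (a * y ^ 2 * b) := by
  have e1 : a * b * (a * y ^ 2 * b) = a * y * b := by
    calc _ = a * (b * a * (y * y)) * b := by noncomm_ring
      _ = _ := by rw [h.mul_self_mul]
  have e2 : a * y ^ 2 * b * (a * b) = a * y * b := by
    calc _ = a * (y * (y * (b * a))) * b := by noncomm_ring
      _ = _ := by rw [h.mul_mul_self']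
  refine of_isQuasinilpotent_mul_one_sub ?_ (e1.trans e2.symm) ?_
  · rw [e1]
    calc _ = a * (y * (y * (b * a))) * (y * b) := by noncomm_ring
      _ = a * y ^ 2 * b := by rw [h.mul_mul_self']; noncomm_ring
  · rw [e1]
    have : a * b * (1 - a * y * b) = a * ((1 - b * a * y) * b) := by noncomm_ring
    rw [this]
    apply IsQuasinilpotent.mul_swap
    rw [mul_assoc]
    exact h.isQuasinilpotent_one_sub_mul

theorem mul_of_commute [CompleteSpace A] (ha : IsGDrazinInverse a x) (hb : IsGDrazinInverse b y)
    (h : Commute a b) : IsGDrazinInverse (a * b) (x * y) := by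
  have hxb : Commute x b := ha.commute_of_commute h
  have hya : Commute y a := hb.commute_of_commute h.symm
  have hyx : Commute y x := hb.commute_of_commute hxb.symm
  have hax : Commute a x := ha.comm
  have hby : Commute b y := hb.comm
  have e : a * b * (x * y) = a * x * (b * y) := hxb.symm.mul_mul_mul_comm a y
  refine of_isQuasinilpotent_mul_one_sub ?_ ?_ ?_
  · rw [e]
    calc _ = (x * (a * x)) * (y * (b * y)) :=
          (hya.mul_right hyx).mul_mul_mul_comm x _
      _ = _ := by rw [ha.mul_mul_self, hb.mul_mul_self]
  · exact ((hax.mul_left hxb.symm).mul_right (hya.symm.mul_left hby)).eq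
  · rw [e]
    have hea : Commute (a * x) b := h.mul_left hxb
    have hfb : Commute a (1 - b * y) :=
      (Commute.one_right a).sub_right (h.mul_right hya.symm)
    have hef : Commute (a * x) (1 - b * y) :=
      (Commute.one_right _).sub_right (hea.mul_right (hya.symm.mul_left hyx.symm))
    have hca : Commute a (1 - a * x) := ha.commute_one_sub
    have hcb : Commute (1 - a * x) b := (Commute.one_left b).sub_left hea
    have hcf : Commute (1 - a * x) (1 - b * y) := (Commute.one_left _).sub_left hef
    have hb1 : Commute b (1 - b * y) := hb.commute_one_sub
    have haa : Commute a (a * x) := (Commute.refl a).mul_right hax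
    have hae : Commute (1 - a * x) (a * x) := (Commute.one_left _).sub_left (Commute.refl _)
    have c1 : Commute (a * (1 - a * x)) b := h.mul_left hcb
    have c2 : Commute (b * (1 - b * y)) (a * (a * x)) :=
      ((h.symm.mul_right hea.symm).mul_left (hfb.symm.mul_right hef.symm))
    -- The remainder is a sum of two commuting terms, each containing the quasinilpotent part of one
    -- factor.
    have : a * b * (1 - a * x * (b * y)) =
        a * (1 - a * x) * b + b * (1 - b * y) * (a * (a * x)) := by
      have h2 : a * b * (a * x * (b * y)) = a * (a * x) * (b * (b * y)) :=
        hea.symm.mul_mul_mul_comm a _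
      rw [c2.eq, mul_sub, h2]
      noncomm_ring
    rw [this]
    refine (ha.isQuasinilpotent_mul_one_sub.mul_of_commute c1).add_of_commute
      (hb.isQuasinilpotent_mul_one_sub.mul_of_commute c2) ?_
    refine Commute.mul_right (Commute.mul_left ?_ ?_) (Commute.mul_left ?_ ?_)
    · exact (h.mul_right hfb).mul_left (hcb.mul_right hcf)
    · exact (Commute.refl b).mul_right hb1
    · exact ((Commute.refl a).mul_right haa).mul_left (hca.symm.mul_right hae)
    · exact h.symm.mul_right hea.symm

theorem of_isIdempotentElem (h : IsIdempotentElem a) : IsGDrazinInverse a a := by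
  refine of_isQuasinilpotent_mul_one_sub ?_ rfl ?_
  · rw [h.eq, h.eq]
  · rw [h.eq, h.mul_one_sub_self]
    exact isQuasinilpotent_zero

end IsGDrazinInverse

/-! ### Series for perturbations and for sums u + v with u v = 0 -/

omit [NormedAlgebra ℂ A] in
theorem tsum_eq_zero_of_succ_eq_zero {f : ℕ → A} (h : ∀ n, f (n + 1) = 0) :
    ∑' n, f n = f 0 :=
  tsum_eq_single 0 fun n hn => by obtain ⟨m, rfl⟩ := Nat.exists_eq_succ_of_ne_zero hn; exact h m

namespace IsGDrazinInverse

variable {a x b y : A}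

theorem mul_self_mul_pow (h : IsGDrazinInverse a x) (n : ℕ) :
    a * x * x ^ (n + 1) = x ^ (n + 1) := by
  rw [pow_succ', ← mul_assoc, h.comm, h.outer]

theorem pow_mul_self_mul (h : IsGDrazinInverse a x) (n : ℕ) :
    x ^ (n + 1) * (a * x) = x ^ (n + 1) := by
  rw [pow_succ, mul_assoc, h.mul_mul_self]

theorem mul_pow_succ_succ (h : IsGDrazinInverse a x) (n : ℕ) :
    a * x ^ (n + 2) = x ^ (n + 1) := by
  rw [pow_succ' x (n + 1), ← mul_assoc, h.mul_self_mul_pow]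

theorem pow_succ_succ_mul (h : IsGDrazinInverse a x) (n : ℕ) :
    x ^ (n + 2) * a = x ^ (n + 1) := by
  rw [pow_succ x (n + 1), mul_assoc, ← h.comm, h.pow_mul_self_mul]

/-- Perturbation by a commuting quasinilpotent element. -/
theorem add_isQuasinilpotent [CompleteSpace A] (hb : IsGDrazinInverse b y) {r : A}
    (hr : IsQuasinilpotent r) (h : Commute r b) :
    Summable (fun n : ℕ => y ^ (n + 1) * (-r) ^ n) ∧
      IsGDrazinInverse (r + b) (∑' n : ℕ, y ^ (n + 1) * (-r) ^ n) := by
  have hs : Summable (fun n : ℕ => y ^ (n + 1) * (-r) ^ n) :=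
    (hr.neg.summable_mul_pow_mul' y 1 y 1).congr fun n => by
      rw [mul_one, mul_one, pow_succ']
  have hyr : Commute y r := hb.commute_of_commute h.symm
  have hby : Commute b y := hb.comm
  set Z := ∑' n : ℕ, y ^ (n + 1) * (-r) ^ n with hZ
  have cr : Commute r Z := Commute.tsum_right _ fun n =>
    (hyr.symm.pow_right _).mul_right ((Commute.refl r).neg_right.pow_right n)
  have cb : Commute b Z := Commute.tsum_right _ fun n =>
    (hby.pow_right _).mul_right (h.symm.neg_right.pow_right n)
  have cy : Commute y Z := Commute.tsum_right _ fun n =>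
    ((Commute.refl y).pow_right _).mul_right (hyr.neg_right.pow_right n)
  -- Since b y^(n+2) = y^(n+1), multiplying by b shifts the series by one; only the term b y is left
  -- over.
  have e1 : b * Z = b * y - Z * r := by
    have h1 : ∀ n : ℕ, b * (y ^ (n + 1 + 1) * (-r) ^ (n + 1)) = -(y ^ (n + 1) * (-r) ^ n * r) := by
      intro n
      rw [← mul_assoc, hb.mul_pow_succ_succ, pow_succ (-r), mul_neg, mul_neg, mul_assoc]
    rw [hZ, ← hs.tsum_mul_left, (hs.mul_left b).tsum_eq_zero_add, ← hs.tsum_mul_right,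
      tsum_congr h1, tsum_neg]
    simp [sub_eq_add_neg]
  have e2 : (r + b) * Z = b * y := by
    rw [add_mul, e1, cr.eq]
    abel
  have e3 : b * y * Z = Z := by
    rw [hZ, ← hs.tsum_mul_left]
    refine tsum_congr fun n => ?_
    rw [← mul_assoc, hb.mul_self_mul_pow]
  refine ⟨hs, of_isQuasinilpotent_mul_one_sub ?_ (cr.add_left cb).eq ?_⟩
  · rw [e2, ← (cb.mul_left cy).eq, e3]
  · have c : Commute r (1 - b * y) :=
      (Commute.one_right r).sub_right (h.mul_right hyr.symm)
    rw [e2, add_mul]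
    refine (hr.mul_of_commute c).add_of_commute hb.isQuasinilpotent_mul_one_sub ?_
    exact (h.mul_right c).mul_left (hb.commute_one_sub.symm.mul_right (Commute.refl _))

theorem summable_one_sub_mul_pow [CompleteSpace A] (h : IsGDrazinInverse a x) (w y z : A) :
    Summable (fun n : ℕ => (1 - a * x) * a ^ n * w * y ^ n * z) := by
  -- The zeroth terms are set aside: ((1 - a x) a)^n = (1 - a x) a^n need not hold at n = 0.
  refine (summable_nat_add_iff 1).1 (((summable_nat_add_iff 1).2
    (h.isQuasinilpotent_one_sub_mul.summable_mul_pow_mul 1 w y z)).congr fun n => ?_)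
  rw [h.pow_one_sub_mul n.succ_pos, one_mul]

theorem summable_pow_mul_one_sub [CompleteSpace A] (h : IsGDrazinInverse a x) (w y z : A) :
    Summable (fun n : ℕ => w * y ^ n * z * a ^ n * (1 - a * x)) := by
  refine (summable_nat_add_iff 1).1 (((summable_nat_add_iff 1).2
    (h.isQuasinilpotent_mul_one_sub.summable_mul_pow_mul' w z y 1)).congr fun n => ?_)
  rw [h.pow_mul_one_sub n.succ_pos, mul_one, mul_assoc _ (a ^ _)]

/-- The generalized Drazin inverse of `u + v` when `u * v = 0`. -/
theorem add_of_mul_eq_zero [CompleteSpace A] {u v u' v' : A} (hu : IsGDrazinInverse u u')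
    (hv : IsGDrazinInverse v v') (huv : u * v = 0) :
    IsGDrazinInverse (u + v) ((∑' n : ℕ, (1 - v * v') * v ^ n * u' ^ (n + 1)) +
      ∑' n : ℕ, v' ^ (n + 1) * u ^ n * (1 - u * u')) := by
  have hS : Summable (fun n : ℕ => (1 - v * v') * v ^ n * u' ^ (n + 1)) :=
    (hv.summable_one_sub_mul_pow 1 u' u').congr fun n => by rw [mul_one, mul_assoc, ← pow_succ]
  have hT : Summable (fun n : ℕ => v' ^ (n + 1) * u ^ n * (1 - u * u')) :=
    (hu.summable_pow_mul_one_sub v' v' 1).congr fun n => by rw [mul_one, ← pow_succ']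
  have u'v : u' * v = 0 := by
    rw [← hu.mul_mul_self', mul_assoc, mul_assoc, huv, mul_zero, mul_zero]
  have uv' : u * v' = 0 := by
    rw [← hv.mul_self_mul, ← mul_assoc, huv, zero_mul]
  have uvp : u * (1 - v * v') = u := by rw [mul_sub, ← mul_assoc, huv]; simp
  have upv : (1 - u * u') * v = v := by rw [sub_mul, mul_assoc, u'v]; simp
  have v'vp : v' * (1 - v * v') = 0 := by rw [mul_sub, hv.mul_mul_self]; simp
  have upup : (1 - u * u') * (1 - u * u') = 1 - u * u' := hu.isIdempotentElem.one_sub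
  have cv : Commute v (1 - v * v') := hv.commute_one_sub
  have cu : Commute u (1 - u * u') := hu.commute_one_sub
  set S := ∑' n : ℕ, (1 - v * v') * v ^ n * u' ^ (n + 1) with hSd
  set T := ∑' n : ℕ, v' ^ (n + 1) * u ^ n * (1 - u * u') with hTd
  have Sv : S * v = 0 := by
    rw [hSd, ← hS.tsum_mul_right]
    refine (tsum_congr fun n => ?_).trans tsum_zero
    rw [pow_succ, mul_assoc, mul_assoc _ u', u'v, mul_zero, mul_zero]
  have uS : u * S = u * u' := by
    rw [hSd, ← hS.tsum_mul_left, tsum_eq_zero_of_succ_eq_zero]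
    · simp [← mul_assoc, uvp]
    · intro n
      rw [pow_succ', ← mul_assoc, ← mul_assoc, ← mul_assoc, uvp, huv, zero_mul, zero_mul]
  have vS : v * S = ∑' n : ℕ, (1 - v * v') * v ^ (n + 1) * u' ^ (n + 1) := by
    rw [hSd, ← hS.tsum_mul_left]
    refine tsum_congr fun n => ?_
    rw [← mul_assoc, ← mul_assoc, cv.eq, mul_assoc _ v, ← pow_succ']
  have Su : S * u = (1 - v * v') * (u * u') + v * S := by
    rw [vS, hSd, ← hS.tsum_mul_right, (hS.mul_right u).tsum_eq_zero_add]
    congr 1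
    · simp [hu.comm, mul_assoc]
    · refine tsum_congr fun n => ?_
      rw [mul_assoc, hu.pow_succ_succ_mul]
  have Su' : S * (u * u') = S := by
    rw [hSd, ← hS.tsum_mul_right]
    refine tsum_congr fun n => ?_
    rw [mul_assoc, hu.pow_mul_self_mul]
  have v'S : v' * S = 0 := by
    rw [hSd, ← hS.tsum_mul_left]
    refine (tsum_congr fun n => ?_).trans tsum_zero
    rw [← mul_assoc, ← mul_assoc, v'vp, zero_mul, zero_mul]
  have uT : u * T = 0 := by
    rw [hTd, ← hT.tsum_mul_left]
    refine (tsum_congr fun n => ?_).trans tsum_zero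
    rw [pow_succ', ← mul_assoc, ← mul_assoc, ← mul_assoc, uv', zero_mul, zero_mul, zero_mul]
  -- Every term of T after the zeroth ends in u (1 - u u'), which kills such a w. This is used for w
  -- = v and w = T.
  have Tmul : ∀ w, u * w = 0 → (1 - u * u') * w = w → T * w = v' * w := by
    intro w h1 h2
    rw [hTd, ← hT.tsum_mul_right, tsum_eq_zero_of_succ_eq_zero]
    · simp [mul_assoc, h2]
    · intro n
      rw [mul_assoc, h2, pow_succ u, mul_assoc, mul_assoc, h1, mul_zero, mul_zero]
  have Tv : T * v = v' * v := Tmul v huv upv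
  have Tu : T * u = ∑' n : ℕ, v' ^ (n + 1) * u ^ (n + 1) * (1 - u * u') := by
    rw [hTd, ← hT.tsum_mul_right]
    refine tsum_congr fun n => ?_
    rw [mul_assoc, ← cu.eq, pow_succ u, mul_assoc, mul_assoc, mul_assoc]
  have vT : v * T = v * v' * (1 - u * u') + T * u := by
    rw [Tu, hTd, ← hT.tsum_mul_left, (hT.mul_left v).tsum_eq_zero_add]
    congr 1
    · simp [mul_assoc]
    · refine tsum_congr fun n => ?_
      rw [← mul_assoc, ← mul_assoc, hv.mul_pow_succ_succ]
  have Tup : T * (1 - u * u') = T := by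
    rw [hTd, ← hT.tsum_mul_right]
    refine tsum_congr fun n => ?_
    rw [mul_assoc, upup]
  have Tuu' : T * (u * u') = 0 := by
    rw [mul_sub, mul_one, sub_eq_self] at Tup
    exact Tup
  have v'Tu : v' * (T * u) = T - v' * (1 - u * u') := by
    rw [eq_sub_iff_add_eq, Tu]
    conv_rhs => rw [hTd, hT.tsum_eq_zero_add]
    rw [add_comm, ← Summable.tsum_mul_left]
    · congr 1
      · simp
      · refine tsum_congr fun n => ?_
        rw [pow_succ' v' (n + 1)]
        simp only [mul_assoc]
    · exact (hT.mul_right u).congr fun n => by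
        rw [mul_assoc, ← cu.eq, pow_succ u, mul_assoc, mul_assoc, mul_assoc]
  have TT : T * T = v' * T := by
    refine Tmul T uT ?_
    rw [sub_mul, hu.comm, mul_assoc, uT]
    simp
  have cvp : v * v' = v' * v := hv.comm
  have e1 : (u + v) * (S + T) = u * u' + v * v' * (1 - u * u') + v * S + T * u := by
    rw [add_mul, mul_add, mul_add, uS, uT, vT]
    abel
  have e2 : (S + T) * (u + v) = u * u' + v * v' * (1 - u * u') + v * S + T * u := by
    rw [add_mul, mul_add, mul_add, Su, Sv, Tv, ← cvp]
    noncomm_ring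
  refine of_isQuasinilpotent_mul_one_sub ?_ (e1.trans e2.symm) ?_
  · rw [e1]
    have h1 : S * (u * u' + v * v' * (1 - u * u') + v * S + T * u) = S + S * (T * u) := by
      simp only [mul_add, Su', ← mul_assoc, Sv, zero_mul, add_zero]
    have h2 : T * (u * u' + v * v' * (1 - u * u') + v * S + T * u) = T := by
      have : T * (v * v' * (1 - u * u')) = v' * (1 - u * u') := by
        rw [← mul_assoc, ← mul_assoc, Tv, hv.outer]
      rw [mul_add, mul_add, mul_add, Tuu', this, ← mul_assoc T v, Tv, ← cvp, mul_assoc, v'S,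
        ← mul_assoc T T, TT, mul_assoc, v'Tu]
      simp
    have h3 : S * (T * u) = 0 := by
      have : v * (v' * T) = T := by
        rw [← mul_assoc, hTd, ← hT.tsum_mul_left]
        refine tsum_congr fun n => ?_
        rw [← mul_assoc, ← mul_assoc, hv.mul_self_mul_pow]
      rw [← this, ← mul_assoc, ← mul_assoc, Sv, zero_mul, zero_mul]
    rw [add_mul, h1, h2, h3, add_zero]
  · rw [e1]
    -- The remainder becomes X + Y with X Y = 0. Exchanging the two factors of X gives u (1 - u u'),
    -- and of Y gives v (1 - v v'), so both are quasinilpotent.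
    have key : (u + v) * (1 - (u * u' + v * v' * (1 - u * u') + v * S + T * u)) =
        (1 - v * T) * (u * (1 - u * u')) + v * (1 - v * v') * ((1 - u * u') - v * S) := by
      have h1 : u * (u * u' + v * v' * (1 - u * u') + v * S + T * u) = u * (u * u') := by
        simp only [mul_add, ← mul_assoc, huv, uT, zero_mul, add_zero]
      have h2 : T * (u * (1 - u * u')) = T * u := by rw [cu.eq, ← mul_assoc, Tup]
      have h3 : v * (v * v') * (v * S) = 0 := by
        rw [mul_assoc, mul_assoc v v', ← mul_assoc v' v, ← cvp, mul_assoc v v', v'S]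
        simp
      calc _ = u - u * (u * u' + v * v' * (1 - u * u') + v * S + T * u) + v * (1 - u * u') -
            v * (v * v') * (1 - u * u') - v * (v * S) - v * (T * u) := by noncomm_ring
        _ = u * (1 - u * u') + v * (1 - u * u') -
            v * (v * v') * (1 - u * u') - v * (v * S) - v * (T * (u * (1 - u * u')))
              + v * (v * v') * (v * S) := by rw [h1, h2, h3]; noncomm_ring
        _ = _ := by noncomm_ring
    rw [key]
    have ut0 : u * (1 - u * u') * (v * (1 - v * v')) = 0 := by
      rw [mul_assoc, ← mul_assoc _ v, upv, ← mul_assoc, huv, zero_mul]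
    refine IsQuasinilpotent.add_of_mul_eq_zero (IsQuasinilpotent.mul_swap ?_)
      (IsQuasinilpotent.mul_swap ?_) ?_
    · have : u * (1 - u * u') * (1 - v * T) = u * (1 - u * u') := by
        rw [mul_sub, mul_one, ← mul_assoc, mul_assoc u, upv, huv]; simp
      rw [this]
      exact hu.isQuasinilpotent_mul_one_sub
    · have : (1 - u * u' - v * S) * (v * (1 - v * v')) = v * (1 - v * v') := by
        rw [sub_mul, ← mul_assoc, upv, ← mul_assoc, mul_assoc v, Sv]; simp
      rw [this]
      exact hv.isQuasinilpotent_mul_one_sub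
    · rw [mul_assoc, ← mul_assoc (u * _), ut0]; simp

end IsGDrazinInverse

/-! ### Block triangular elements and their corners -/

theorem IsQuasinilpotent.of_norm_pow_le [CompleteSpace A] {r s : A} (hr : IsQuasinilpotent r)
    (K : ℝ) (h : ∀ n, 0 < n → ‖s ^ n‖ ≤ K * ‖r ^ n‖) : IsQuasinilpotent s := by
  refine isQuasinilpotent_of_summable fun C hC => ?_
  refine Summable.of_norm_bounded_eventually_nat ((hr.summable_mul_norm_pow C hC).mul_left K) ?_
  filter_upwards [eventually_gt_atTop 0] with n hn
  rw [Real.norm_of_nonneg (by positivity), mul_left_comm]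
  gcongr
  exact h n hn

/-- If `p * z * p = p * z`, then multiplication by `p` intertwines the powers of `z` and `p * z`. -/
theorem mul_pow_eq_of_mul_mul_eq {M : Type*} [Monoid M] {p z : M} (h : p * z * p = p * z) (n : ℕ) :
    p * z ^ n = (p * z) ^ n * p :=
  SemiconjBy.pow_right (show SemiconjBy p z (p * z) from h.symm) n

theorem pow_mul_eq_of_mul_mul_eq {M : Type*} [Monoid M] {q z : M} (h : q * z * q = z * q) (n : ℕ) :
    q * (z * q) ^ n = z ^ n * q :=
  SemiconjBy.pow_right (show SemiconjBy q (z * q) z by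
    rw [SemiconjBy, ← mul_assoc, h]) n

theorem mul_mul_mul_eq_left {M : Type*} [Monoid M] {p z w : M} (hz : p * z * p = p * z)
    (hw : p * w * p = p * w) : p * (z * w) * p = p * (z * w) := by
  calc _ = p * z * p * (w * p) := by rw [hz]; simp only [mul_assoc]
    _ = p * z * (p * w * p) := by simp only [mul_assoc]
    _ = p * z * p * w := by rw [hw]; simp only [mul_assoc]
    _ = _ := by rw [hz, mul_assoc]

theorem mul_mul_mul_eq_right {M : Type*} [Monoid M] {q z w : M} (hz : q * z * q = z * q)
    (hw : q * w * q = w * q) : q * (z * w) * q = z * w * q := by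
  calc _ = q * z * (w * q) := by simp only [mul_assoc]
    _ = q * z * (q * w * q) := by rw [hw]
    _ = q * z * q * (w * q) := by simp only [mul_assoc]
    _ = z * (q * w * q) := by rw [hz]; simp only [mul_assoc]
    _ = _ := by rw [hw, mul_assoc]

theorem mul_pow_succ_eq {M : Type*} [Monoid M] {p z : M} (h : p * z * p = p * z) (n : ℕ) :
    (p * z) ^ (n + 1) = p * z ^ (n + 1) := by
  rw [pow_succ z, ← mul_assoc, mul_pow_eq_of_mul_mul_eq h, mul_assoc, ← pow_succ]

theorem pow_succ_mul_eq {M : Type*} [Monoid M] {q z : M} (h : q * z * q = z * q) (n : ℕ) :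
    (z * q) ^ (n + 1) = z ^ (n + 1) * q := by
  rw [pow_succ' (z * q), mul_assoc, pow_mul_eq_of_mul_mul_eq h, ← mul_assoc, ← pow_succ']

theorem IsQuasinilpotent.mul_left_of_mul_mul_eq [CompleteSpace A] {p z : A}
    (hz : IsQuasinilpotent z) (h : p * z * p = p * z) : IsQuasinilpotent (p * z) := by
  refine hz.of_norm_pow_le ‖p‖ fun n hn => ?_
  obtain ⟨m, rfl⟩ := Nat.exists_eq_succ_of_ne_zero hn.ne'
  rw [mul_pow_succ_eq h]
  exact norm_mul_le _ _

theorem IsQuasinilpotent.mul_right_of_mul_mul_eq [CompleteSpace A] {q z : A}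
    (hz : IsQuasinilpotent z) (h : q * z * q = z * q) : IsQuasinilpotent (z * q) := by
  refine hz.of_norm_pow_le ‖q‖ fun n hn => ?_
  obtain ⟨m, rfl⟩ := Nat.exists_eq_succ_of_ne_zero hn.ne'
  rw [pow_succ_mul_eq h, mul_comm ‖q‖]
  exact norm_mul_le _ _

namespace IsGDrazinInverse

variable {a x b y : A}

theorem neg (h : IsGDrazinInverse a x) : IsGDrazinInverse (-a) (-x) := by
  refine of_isQuasinilpotent_mul_one_sub ?_ ?_ ?_
  · rw [neg_mul_neg, neg_mul, h.mul_mul_self]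
  · rw [neg_mul_neg, neg_mul_neg, h.comm]
  · rw [neg_mul_neg, neg_mul]
    exact h.isQuasinilpotent_mul_one_sub.neg

/-- The generalized Drazin inverse of `aᵈ` is `a² aᵈ`. -/
theorem symm (h : IsGDrazinInverse a x) : IsGDrazinInverse x (a * (a * x)) := by
  have e1 : x * (a * (a * x)) = a * x := by rw [← mul_assoc, ← h.comm, h.isIdempotentElem.eq]
  have e2 : a * (a * x) * x = a * x := by
    rw [mul_assoc, h.comm, mul_assoc, ← h.comm, h.mul_mul_self]
  refine of_isQuasinilpotent_mul_one_sub ?_ (e1.trans e2.symm) ?_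
  · rw [e1, mul_assoc, h.isIdempotentElem.eq]
  · rw [e1, mul_sub, h.mul_mul_self, mul_one, sub_self]
    exact isQuasinilpotent_zero

/-- The left upper corner of a triangular element whose generalized Drazin inverse is
triangular. -/
theorem corner_left [CompleteSpace A] {p : A} (h : IsGDrazinInverse a x)
    (hpa : p * a * p = p * a) (hpx : p * x * p = p * x) :
    IsGDrazinInverse (p * a) (p * x) := by
  have e1 : ∀ w, p * a * (p * w) = p * (a * w) := fun w => by rw [← mul_assoc, hpa, mul_assoc]
  have e2 : ∀ w, p * x * (p * w) = p * (x * w) := fun w => by rw [← mul_assoc, hpx, mul_assoc]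
  refine of_isQuasinilpotent_mul_one_sub ?_ ?_ ?_
  · rw [e1, e2, h.mul_mul_self]
  · rw [e1, e2, h.comm]
  · have : p * a * (1 - p * a * (p * x)) = p * (a * (1 - a * x)) := by
      rw [e1, mul_sub, e1]
      noncomm_ring
    rw [this]
    refine h.isQuasinilpotent_mul_one_sub.mul_left_of_mul_mul_eq ?_
    have e3 : p * (a * (a * x)) * p = p * (a * (a * x)) := by
      exact mul_mul_mul_eq_left hpa (mul_mul_mul_eq_left hpa hpx)
    calc _ = p * a * p - p * (a * (a * x)) * p := by noncomm_ring
      _ = _ := by rw [e3, hpa]; noncomm_ring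

/-- The right lower corner of a triangular element whose generalized Drazin inverse is
triangular. -/
theorem corner_right [CompleteSpace A] {q : A} (h : IsGDrazinInverse a x)
    (hqa : q * a * q = a * q) (hqx : q * x * q = x * q) :
    IsGDrazinInverse (a * q) (x * q) := by
  have e1 : ∀ w, w * q * (a * q) = w * (a * q) := fun w => by
    rw [mul_assoc, ← mul_assoc q, hqa]
  have e2 : ∀ w, w * q * (x * q) = w * (x * q) := fun w => by
    rw [mul_assoc, ← mul_assoc q, hqx]
  have hqax := mul_mul_mul_eq_right hqa hqx
  refine of_isQuasinilpotent_mul_one_sub ?_ ?_ ?_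
  · rw [e2, ← mul_assoc a, mul_assoc x, ← mul_assoc q, hqax, ← mul_assoc,
      h.mul_mul_self]
  · rw [e2, e1, ← mul_assoc, ← mul_assoc, h.comm]
  · have : a * q * (1 - a * q * (x * q)) = a * (1 - a * x) * q := by
      rw [e2, mul_sub, mul_one, mul_assoc a q, ← mul_assoc a x, ← mul_assoc q, hqax]
      noncomm_ring
    rw [this]
    refine h.isQuasinilpotent_mul_one_sub.mul_right_of_mul_mul_eq ?_
    have e3 : q * (a * a * x) * q = a * a * x * q :=
      mul_mul_mul_eq_right (mul_mul_mul_eq_right hqa hqa) hqx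
    calc _ = q * a * q - q * (a * a * x) * q := by noncomm_ring
      _ = _ := by rw [e3, hqa]; noncomm_ring

/-- The relation (p a) p = p a says that p intertwines p a with a, hence also their inverses: y p =
p x, and p is idempotent. -/
theorem mul_mul_eq_of_left [CompleteSpace A] {p : A} (hp : IsIdempotentElem p)
    (h : IsGDrazinInverse a x) (hy : IsGDrazinInverse (p * a) y) (hpa : p * a * p = p * a) :
    p * x * p = p * x := by
  rw [← hy.mul_eq_mul h hpa, mul_assoc, hp.eq]

theorem mul_mul_eq_of_right [CompleteSpace A] {q : A} (hq : IsIdempotentElem q)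
    (h : IsGDrazinInverse a x) (hy : IsGDrazinInverse (a * q) y) (hqa : q * a * q = a * q) :
    q * x * q = x * q := by
  rw [h.mul_eq_mul hy (t := q) (by rw [← mul_assoc, hqa]), mul_assoc,
    h.mul_eq_mul hy (t := q) (by rw [← mul_assoc, hqa]), ← mul_assoc, hq.eq]

/-- The generalized Drazin inverse of a triangular element in terms of its corners. -/
theorem of_corners [CompleteSpace A] {p : A} (hp : IsIdempotentElem p)
    (hpa : p * a * p = p * a) (hx : IsGDrazinInverse (p * a) x)
    (hy : IsGDrazinInverse (a * (1 - p)) y) :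
    IsGDrazinInverse a
      ((∑' n : ℕ, (1 - a * (1 - p) * y) * (a * (1 - p)) ^ n * (a * x ^ (n + 2))) +
        ∑' n : ℕ, y ^ (n + 1) * (a * p) ^ n * (1 - a * x)) := by
  have px : p * x = x := by
    rw [← hx.mul_self_mul]
    simp only [← mul_assoc, hp.eq]
  have xp : x * p = x := by
    rw [← hx.mul_mul_self', mul_assoc, mul_assoc, hpa]
  -- The sum formula needs the summand a p rather than the corner p a; Cline's formula converts the
  -- inverse.
  have hw : IsGDrazinInverse (a * p) (a * x ^ 2) := by
    have h1 : IsGDrazinInverse (p * (a * p)) x := by rwa [← mul_assoc, hpa]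
    have h2 := h1.mul_swap
    have h3 : a * p * x ^ 2 * p = a * x ^ 2 := by
      rw [pow_two]
      simp only [mul_assoc, xp]
      rw [← mul_assoc p, px]
    rwa [h3, mul_assoc, hp.eq] at h2
  have hwn : ∀ n : ℕ, (a * x ^ 2) ^ (n + 1) = a * x ^ (n + 2) := by
    intro n
    induction n with
    | zero => simp
    | succ n ih =>
      have h1 : x ^ (n + 2) * a = x ^ (n + 1) := by
        rw [← hx.pow_succ_succ_mul n, pow_succ x (n + 1)]
        simp only [← mul_assoc]
        rw [mul_assoc _ x p, xp]
      rw [pow_succ, ih, mul_assoc, ← mul_assoc _ a, h1, ← pow_add]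
  have hwp : a * p * (a * x ^ 2) = a * x := by
    rw [pow_two, mul_assoc, ← mul_assoc p, hx.mul_self_mul]
  have h0 : a * p * (a * (1 - p)) = 0 := by
    rw [mul_assoc, ← mul_assoc p, mul_sub, hpa]
    simp
  have key := hw.add_of_mul_eq_zero hy h0
  rw [← mul_add, add_sub_cancel, mul_one, hwp] at key
  simpa only [hwn] using key

end IsGDrazinInverse

/-- A triangular element with generalized Drazin invertible right lower corner is generalized
Drazin invertible iff its left upper corner is. -/
theorem isGDrazinInvertible_iff_corner [CompleteSpace A] {a p : A} (hp : IsIdempotentElem p)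
    (hpa : p * a * p = p * a) (h : IsGDrazinInvertible (a * (1 - p))) :
    IsGDrazinInvertible a ↔ IsGDrazinInvertible (p * a) := by
  obtain ⟨y, hy⟩ := h
  constructor
  · rintro ⟨x, hx⟩
    have h1 := hx.mul_mul_eq_of_right hp.one_sub hy (by
      rw [sub_mul, sub_mul, one_mul, mul_sub (p * a), hpa]; simp)
    refine ⟨_, hx.corner_left hpa ?_⟩
    rw [sub_mul, sub_mul, one_mul, sub_eq_self, mul_sub, mul_one, sub_eq_zero] at h1
    exact h1.symm
  · rintro ⟨x, hx⟩
    exact ⟨_, IsGDrazinInverse.of_corners hp hpa hx hy⟩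

theorem isGDrazinInvertible_mul_comm {a b : A} :
    IsGDrazinInvertible (a * b) ↔ IsGDrazinInvertible (b * a) :=
  ⟨fun ⟨_, h⟩ => ⟨_, h.mul_swap⟩, fun ⟨_, h⟩ => ⟨_, h.mul_swap⟩⟩

theorem mul_mul_one_sub_eq_zero_iff {R : Type*} [Ring R] {p b : R} :
    p * b * (1 - p) = 0 ↔ p * b * p = p * b := by
  rw [mul_sub, mul_one, sub_eq_zero, eq_comm]

theorem mul_mul_one_sub_eq {R : Type*} [Ring R] {p b : R} (h : p * b * p = p * b) :
    (1 - p) * b * (1 - p) = b * (1 - p) := by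
  rw [sub_mul, sub_mul, one_mul, mul_mul_one_sub_eq_zero_iff.2 h, sub_zero]

theorem mul_mul_eq_of_one_sub {R : Type*} [Ring R] {p b : R}
    (h : (1 - p) * b * (1 - p) = b * (1 - p)) : p * b * p = p * b := by
  rwa [sub_mul, sub_mul, one_mul, sub_eq_self, mul_mul_one_sub_eq_zero_iff] at h

/-! ### The corner (a + b) a^π and the inverse of a + b from its corners -/

namespace IsGDrazinInverse

variable {a x b y : A}

theorem mul_one_sub_eq_zero (h : IsGDrazinInverse a x) : x * (1 - a * x) = 0 := by
  rw [mul_sub, h.mul_mul_self, mul_one, sub_self]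

theorem commute_mul (h : IsGDrazinInverse a x) : Commute a (a * x) :=
  (Commute.refl a).mul_right h.comm

theorem mul_mul_eq_of_compat (ha : IsGDrazinInverse a x)
    (hab : a * b * (1 - a * x) = (1 - a * x) * b * a * (1 - a * x)) :
    a * x * b * (a * x) = a * x * b := by
  rw [← mul_mul_one_sub_eq_zero_iff, ha.comm]
  rw [ha.comm] at hab
  calc _ = x * (a * b * (1 - x * a)) := by simp only [mul_assoc]
    _ = 0 := by
      rw [hab, ← ha.comm]
      simp only [← mul_assoc, ha.mul_one_sub_eq_zero, zero_mul]

/-- Because q b q = b q for q = 1 - a x, both products of the corners reduce to the two sides of the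
hypothesis. -/
theorem commute_corner_of_compat (ha : IsGDrazinInverse a x)
    (hab : a * b * (1 - a * x) = (1 - a * x) * b * a * (1 - a * x)) :
    Commute (a * (1 - a * x)) (b * (1 - a * x)) := by
  have hb := ha.mul_mul_eq_of_compat hab
  have hq := ha.commute_one_sub
  have hqq : (1 - a * x) * (1 - a * x) = 1 - a * x := ha.isIdempotentElem.one_sub
  change _ = _
  calc _ = a * ((1 - a * x) * b * (1 - a * x)) := by simp only [mul_assoc]
    _ = (1 - a * x) * b * a * (1 - a * x) := by
      rw [mul_mul_one_sub_eq hb, ← mul_assoc, hab]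
    _ = (1 - a * x) * b * (1 - a * x) * (a * (1 - a * x)) := by
      rw [mul_assoc _ (1 - a * x) (a * _), ← mul_assoc (1 - a * x) a, ← hq.eq, mul_assoc a, hqq,
        mul_assoc _ a]
    _ = _ := by rw [mul_mul_one_sub_eq hb]

/-- The corner `(a + b) a^π` is generalized Drazin invertible. -/
theorem corner_add [CompleteSpace A] (ha : IsGDrazinInverse a x)
    (hab : a * b * (1 - a * x) = (1 - a * x) * b * a * (1 - a * x))
    (hb : IsGDrazinInverse (b * (1 - a * x)) (y * (1 - a * x)))
    (hy : (1 - a * x) * y * (1 - a * x) = y * (1 - a * x)) :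
    Summable (fun n : ℕ => y ^ (n + 1) * (-a) ^ n * (1 - a * x)) ∧
    IsGDrazinInverse ((a + b) * (1 - a * x))
      (∑' n : ℕ, y ^ (n + 1) * (-a) ^ n * (1 - a * x)) := by
  have h := hb.add_isQuasinilpotent ha.isQuasinilpotent_mul_one_sub
    (ha.commute_corner_of_compat hab)
  have hq : Commute (-a) (1 - a * x) := ha.commute_one_sub.neg_left
  have hqa : (1 - a * x) * (-a) * (1 - a * x) = -a * (1 - a * x) := by
    rw [← hq.eq, mul_assoc, ha.isIdempotentElem.one_sub.eq]
  -- Triangularity of y and a lets all factors 1 - a x in the perturbation series collapse into the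
  -- last one.
  have e : ∀ n : ℕ, (y * (1 - a * x)) ^ (n + 1) * (-(a * (1 - a * x))) ^ n =
      y ^ (n + 1) * (-a) ^ n * (1 - a * x) := by
    intro n
    rw [pow_succ_mul_eq hy, ← neg_mul, mul_assoc, pow_mul_eq_of_mul_mul_eq hqa, mul_assoc]
  rw [add_mul]
  simpa only [e] using h

/-- The generalized Drazin inverse of the sum of a diagonal and a triangular element in terms of
its corners. -/
theorem add_of_corners [CompleteSpace A] {p c c' s : A} (hp : IsIdempotentElem p)
    (hpa : Commute p a) (hpb : p * b * p = p * b) (hcd : c = p * (a + b))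
    (hc : IsGDrazinInverse c c') (hs : IsGDrazinInverse ((a + b) * (1 - p)) s) :
    Summable (fun n : ℕ => s ^ (n + 2) * b * p * c ^ n * (1 - c * c')) ∧
    Summable (fun n : ℕ => (a + b) ^ n * (1 - p) * b * c' ^ (n + 2) -
      s * ((a + b) ^ (n + 1) * (1 - p) * b * c' ^ (n + 2))) ∧
    IsGDrazinInverse (a + b) (c' + s - s * (b * c') +
      (∑' n : ℕ, s ^ (n + 2) * b * p * c ^ n * (1 - c * c')) +
      ∑' n : ℕ, ((a + b) ^ n * (1 - p) * b * c' ^ (n + 2) -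
        s * ((a + b) ^ (n + 1) * (1 - p) * b * c' ^ (n + 2)))) := by
  have hwp : p * (a + b) * p = p * (a + b) := by
    rw [mul_add, add_mul, hpb, hpa.eq, mul_assoc, hp.eq]
  have hq : (1 - p) * (a + b) * (1 - p) = (a + b) * (1 - p) := mul_mul_one_sub_eq hwp
  have hs3 : Summable (fun n : ℕ => s ^ (n + 2) * b * p * c ^ n * (1 - c * c')) :=
    (hc.summable_pow_mul_one_sub (s ^ 2) s (b * p)).congr fun n => by
      rw [← pow_add, add_comm 2, ← mul_assoc]
  subst hcd
  have key := of_corners hp hwp hc hs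
  have sq : s * (1 - p) = s := by
    rw [← hs.mul_mul_self']
    simp only [mul_assoc, hp.one_sub.eq]
  have pc : p * c' = c' := by
    rw [← hc.mul_self_mul]
    simp only [← mul_assoc, hp.eq]
  have qc : (1 - p) * c' = 0 := by rw [sub_mul, pc, one_mul, sub_self]
  have qac : ∀ w, (1 - p) * (a * (p * w)) = 0 := fun w => by
    have : (1 - p) * (a * (p * w)) = (1 - p) * p * (a * w) := by
      simp only [mul_assoc, hpa.left_comm]
    rw [this, hp.one_sub_mul_self, zero_mul]
  -- As a is block diagonal, only b contributes to the off-diagonal block; this is why b alone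
  -- appears in the final series.
  have qabp : ∀ w, (1 - p) * ((a + b) * (p * w)) = (1 - p) * (b * (p * w)) := fun w => by
    rw [add_mul, mul_add, qac, zero_add]
  have qabc : ∀ w, (1 - p) * ((a + b) * (c' * w)) = (1 - p) * (b * (c' * w)) := fun w => by
    have := qabp (c' * w)
    rwa [← mul_assoc p, pc] at this
  have hpow' : ∀ n : ℕ, (a + b) ^ n * (1 - p) = ((a + b) * (1 - p)) ^ n * (1 - p) := by
    intro n
    cases n with
    | zero => simp
    | succ n => rw [pow_succ_mul_eq hq, mul_assoc, hp.one_sub.eq]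
  -- The difference carries the spectral idempotent of (a + b)(1 - p), which makes the powers decay
  -- and the series converge.
  have hF : ∀ n : ℕ, (a + b) ^ n * (1 - p) * b * c' ^ (n + 2) -
      s * ((a + b) ^ (n + 1) * (1 - p) * b * c' ^ (n + 2)) =
      (1 - (a + b) * (1 - p) * s) * ((a + b) * (1 - p)) ^ n * ((1 - p) * b) * c' ^ n * c' ^ 2 := by
    intro n
    rw [hpow', hpow', hs.comm, pow_succ' _ n, pow_add c']
    noncomm_ring
  have hs4 : Summable (fun n : ℕ => (a + b) ^ n * (1 - p) * b * c' ^ (n + 2) -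
      s * ((a + b) ^ (n + 1) * (1 - p) * b * c' ^ (n + 2))) :=
    (hs.summable_one_sub_mul_pow ((1 - p) * b) c' (c' ^ 2)).congr fun n => (hF n).symm
  refine ⟨hs3, hs4, ?_⟩
  have hsG : Summable (fun n : ℕ =>
      (1 - (a + b) * (1 - p) * s) * ((a + b) * (1 - p)) ^ n * c' ^ (n + 1)) :=
    (hs.summable_one_sub_mul_pow 1 c' c').congr fun n => by rw [mul_one, mul_assoc, ← pow_succ]
  have sc : s * c' = 0 := by rw [← sq, mul_assoc, qc, mul_zero]
  have hG : ∑' n : ℕ, (1 - (a + b) * (1 - p) * s) * ((a + b) * (1 - p)) ^ n * c' ^ (n + 1) =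
      c' := by
    rw [tsum_eq_zero_of_succ_eq_zero]
    · rw [pow_zero, mul_one, zero_add, pow_one, sub_mul, mul_assoc _ s, sc]
      simp
    · intro n
      rw [pow_succ, pow_succ' c', ← mul_assoc, mul_assoc _ _ c', mul_assoc _ _ c',
        mul_assoc _ _ c', qc]
      simp
  have e1 : ∑' n : ℕ, (1 - (a + b) * (1 - p) * s) * ((a + b) * (1 - p)) ^ n *
      ((a + b) * c' ^ (n + 2)) = c' + ∑' n : ℕ, ((a + b) ^ n * (1 - p) * b * c' ^ (n + 2) -
        s * ((a + b) ^ (n + 1) * (1 - p) * b * c' ^ (n + 2))) := by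
    refine ((tsum_congr ?_).trans (hsG.tsum_add hs4)).trans (congrArg (· + _) hG)
    intro n
    -- Split into the p and 1 - p components. The first ones sum to c', as (1 - p) c' = 0 leaves
    -- only n = 0.
    have h1 : (a + b) * c' ^ (n + 2) = c' ^ (n + 1) + (1 - p) * (b * c' ^ (n + 2)) := by
      have h2 := qabc (c' ^ (n + 1))
      rw [← pow_succ'] at h2
      rw [← hc.mul_pow_succ_succ n, ← h2]
      noncomm_ring
    rw [hF, h1, mul_add]
    congr 1
    rw [pow_add]
    simp only [mul_assoc]
  have hcomm : ∀ n : ℕ, Commute p ((p * (a + b)) ^ n) := fun n =>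
    Commute.pow_right (by rw [Commute, SemiconjBy, hwp, ← mul_assoc, hp.eq]) n
  -- The zeroth term gives s - s b c'; the shift by one accounts for the exponent n + 2 of s.
  have e2 : ∑' n : ℕ, s ^ (n + 1) * ((a + b) * p) ^ n * (1 - (a + b) * c') =
      s - s * (b * c') + ∑' n : ℕ, s ^ (n + 2) * b * p * (p * (a + b)) ^ n *
        (1 - p * (a + b) * c') := by
    have hn : ∀ n : ℕ, s ^ (n + 1 + 1) * ((a + b) * p) ^ (n + 1) * (1 - (a + b) * c') =
        s ^ (n + 2) * b * p * (p * (a + b)) ^ n * (1 - p * (a + b) * c') := by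
      intro n
      have h1 : ((a + b) * p) ^ (n + 1) = (a + b) * (p * (p * (a + b)) ^ n) := by
        have h2 : (p * ((a + b) * p)) = p * (a + b) := by rw [← mul_assoc, hwp]
        have h3 : p * ((a + b) * p) * p = p * ((a + b) * p) := by
          rw [mul_assoc, mul_assoc, hp.eq]
        have h4 := mul_pow_eq_of_mul_mul_eq h3 n
        rw [h2] at h4
        rw [pow_succ', mul_assoc, h4, ← (hcomm n).eq]
      have h5 : p * (p * (a + b)) ^ n * (1 - (a + b) * c') =
          p * ((p * (a + b)) ^ n * (1 - p * (a + b) * c')) := by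
        have : p * (1 - (a + b) * c') = p * (1 - p * (a + b) * c') := by
          rw [mul_sub, mul_sub, ← mul_assoc, ← mul_assoc, ← mul_assoc, hp.eq]
        rw [(hcomm n).eq, mul_assoc, this, ← mul_assoc, ← (hcomm n).eq, mul_assoc]
      have h6 : s ^ (n + 2) = s ^ (n + 2) * (1 - p) := by
        rw [pow_succ, mul_assoc, sq]
      rw [h1, mul_assoc, mul_assoc (a + b), h5, h6, mul_assoc, qabp]
      simp only [mul_assoc]
    have h0 : s ^ (0 + 1) * ((a + b) * p) ^ 0 * (1 - (a + b) * c') = s - s * (b * c') := by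
      have h1 := qabc 1
      rw [mul_one] at h1
      rw [zero_add, pow_one, pow_zero, mul_one, mul_sub, mul_one, ← sq, mul_assoc s, mul_assoc s,
        h1]
    rw [Summable.tsum_eq_zero_add, h0, tsum_congr hn]
    exact (summable_nat_add_iff 1).1 (hs3.congr fun n => (hn n).symm)
  rw [e1, e2] at key
  convert key using 1
  abel

end IsGDrazinInverse

/-! ### The corner a a^d (a + b) and the element 1 + a^d b -/

namespace IsGDrazinInverse

variable {a x b y g : A}

theorem commute_mul_add (ha : IsGDrazinInverse a x) (hc : Commute a (a * x * b)) :
    Commute a (a * x * (a + b)) := by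
  rw [mul_add]
  exact (ha.commute_mul.mul_right (Commute.refl a)).add_right hc

theorem commute_one_add (ha : IsGDrazinInverse a x) (hc : Commute a (a * x * b)) :
    Commute a (a * x * (1 + x * b)) := by
  have h1 : a * x * (x * b) = x * b := by
    rw [ha.comm, mul_assoc x a, ← mul_assoc a x, ← mul_assoc x, ha.mul_mul_self]
  have h2 : x * (a * x * b) = x * b := by rw [← mul_assoc, ha.mul_mul_self]
  have h3 : Commute a (x * b) := by
    rw [← h2]
    exact (show Commute a x from ha.comm).mul_right hc
  rw [mul_add, h1, mul_one]
  exact ha.commute_mul.add_right h3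

theorem mul_one_add_eq (ha : IsGDrazinInverse a x) :
    a * (a * x * (1 + x * b)) = a * x * (a + b) := by
  calc _ = a * (a * x) + a * (a * (x * x)) * b := by noncomm_ring
    _ = _ := by rw [ha.mul_self_mul, ha.commute_mul.eq]; noncomm_ring

theorem mul_add_eq (ha : IsGDrazinInverse a x) :
    x * (a * x * (a + b)) = a * x * (1 + x * b) := by
  calc _ = x * (a * x) * (a + b) := by noncomm_ring
    _ = x * a + a * (x * x) * b := by rw [ha.mul_mul_self, ha.mul_self_mul]; noncomm_ring
    _ = _ := by rw [← ha.comm]; noncomm_ring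

theorem corner_add_of_one_add [CompleteSpace A] (ha : IsGDrazinInverse a x)
    (hc : Commute a (a * x * b)) (hg : IsGDrazinInverse (a * x * (1 + x * b)) g) :
    IsGDrazinInverse (a * x * (a + b)) (x * g) := by
  rw [← ha.mul_one_add_eq]
  exact ha.mul_of_commute hg (ha.commute_one_add hc)

/-- Multiplication by x = a^d undoes the factor a; x is itself invertible in the generalized sense
and commutes with the corner. -/
theorem one_add_of_corner_add [CompleteSpace A] (ha : IsGDrazinInverse a x)
    (hc : Commute a (a * x * b)) (hg : IsGDrazinInverse (a * x * (a + b)) g) :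
    IsGDrazinInverse (a * x * (1 + x * b)) (a * (a * x) * g) := by
  rw [← ha.mul_add_eq]
  exact ha.symm.mul_of_commute hg (ha.commute_of_commute (ha.commute_mul_add hc))

theorem mul_one_add_mul_one_sub (ha : IsGDrazinInverse a x)
    (hpb : a * x * b * (a * x) = a * x * b) : (1 + x * b) * (1 - a * x) = 1 - a * x := by
  have : x * b * (1 - a * x) = x * (a * x * b * (1 - a * x)) := by
    simp only [← mul_assoc, ha.outer]
  rw [add_mul, this, mul_mul_one_sub_eq_zero_iff.2 hpb]
  simp

/-- Both off-diagonal blocks of x b vanish: x b (1 - a x) = 0 by triangularity of b, and a x · x b =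
x b. -/
theorem one_add_mul (ha : IsGDrazinInverse a x)
    (hpb : a * x * b * (a * x) = a * x * b) :
    (1 + x * b) * (a * x) = a * x * (1 + x * b) := by
  have h := ha.mul_one_add_mul_one_sub hpb
  have h1 : a * x * (x * b) = x * b := by
    rw [ha.comm, mul_assoc x a, ← mul_assoc a x, ← mul_assoc x, ha.mul_mul_self]
  rw [mul_sub, mul_one, sub_eq_iff_eq_add] at h
  rw [mul_add, h1]
  have h2 := eq_sub_of_add_eq' h.symm
  rw [h2]
  noncomm_ring

theorem isGDrazinInvertible_one_add_iff [CompleteSpace A] (ha : IsGDrazinInverse a x)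
    (hpb : a * x * b * (a * x) = a * x * b) :
    IsGDrazinInvertible (1 + x * b) ↔ IsGDrazinInvertible (a * x * (1 + x * b)) := by
  refine isGDrazinInvertible_iff_corner ha.isIdempotentElem ?_ ?_
  · rw [mul_assoc, ha.one_add_mul hpb, ← mul_assoc, ha.isIdempotentElem.eq]
  · rw [ha.mul_one_add_mul_one_sub hpb]
    exact ⟨_, of_isIdempotentElem ha.isIdempotentElem.one_sub⟩

/-- The generalized Drazin inverse of the corner `a aᵈ (a + b)`. -/
theorem corner_add_of_isGDrazinInverse_one_add [CompleteSpace A] (ha : IsGDrazinInverse a x)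
    (hpb : a * x * b * (a * x) = a * x * b) (hc : Commute a (a * x * b))
    (hg : IsGDrazinInverse (1 + x * b) g) :
    IsGDrazinInverse (a * x * (a + b)) (x * g) := by
  have hp := ha.isIdempotentElem
  have h1 : a * x * (1 + x * b) * (a * x) = a * x * (1 + x * b) := by
    rw [mul_assoc, ha.one_add_mul hpb, ← mul_assoc, hp.eq]
  have hq : IsGDrazinInverse ((1 + x * b) * (1 - a * x)) (1 - a * x) := by
    rw [ha.mul_one_add_mul_one_sub hpb]
    exact of_isIdempotentElem hp.one_sub
  have h2 := mul_mul_eq_of_one_sub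
    (hg.mul_mul_eq_of_right hp.one_sub hq (mul_mul_one_sub_eq h1))
  have h3 := ha.corner_add_of_one_add hc (hg.corner_left h1 h2)
  rwa [← mul_assoc, ha.mul_mul_self] at h3

theorem summable_specIdem_mul_neg_pow [CompleteSpace A] (hb : IsGDrazinInverse b y) (x : A) :
    Summable (fun n : ℕ => (1 - b * y) * (-b) ^ n * x ^ (n + 1)) := by
  refine (hb.neg.summable_one_sub_mul_pow 1 x x).congr fun n => ?_
  rw [neg_mul_neg, mul_one, mul_assoc, ← pow_succ]

/-- The part of the generalized Drazin inverse of `a aᵈ (a + b)` on the range of `b^π`. -/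
theorem corner_add_mul_one_sub [CompleteSpace A] {c : A} (ha : IsGDrazinInverse a x)
    (hb : IsGDrazinInverse b y)
    (hpb : a * x * b * (a * x) = a * x * b) (hpy : a * x * y * (a * x) = a * x * y)
    (hc : Commute a (a * x * b)) (hcc : IsGDrazinInverse (a * x * (a + b)) c) :
    c * (1 - b * y) = a * x * ∑' n : ℕ, (1 - b * y) * (-b) ^ n * x ^ (n + 1) := by
  have hp := ha.isIdempotentElem
  have hap := ha.commute_mul
  have hb1 := hb.corner_left hpb hpy
  have hxb := ha.commute_of_commute hc
  have hya := hb1.commute_of_commute hc.symm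
  have hbp : Commute (a * x) (a * x * b) := hc.mul_left hxb
  generalize hpd : a * x = p at *
  -- This is the spectral idempotent at 0 of p b, taken within the corner of p, so it commutes with
  -- a and with p b.
  set f := p * (1 - b * y) with hf
  have hf1 : f = p - p * b * (p * y) := by
    rw [hf, ← mul_assoc (p * b), hpb]
    noncomm_ring
  have hfp : f * p = f := by
    rw [hf1, sub_mul, hp.eq, mul_assoc _ _ p, hpy]
  have hpf : p * f = f := by rw [hf, ← mul_assoc, hp.eq]
  have hff : IsIdempotentElem f := by
    have h1 : p * b * (p * y) * p = p * b * (p * y) := by rw [mul_assoc, hpy]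
    have h2 : p * (p * b * (p * y)) = p * b * (p * y) := by simp only [← mul_assoc, hp.eq]
    change f * f = f
    rw [hf1, mul_sub, sub_mul, sub_mul, h1, h2, hp.eq, hb1.isIdempotentElem.eq]
    abel
  have haf : Commute a f := by
    rw [hf1]
    exact hap.sub_right (hc.mul_right hya.symm)
  have hxf : Commute x f := ha.commute_of_commute haf
  have hbf : Commute (p * b) f := by
    rw [hf1]
    exact hbp.symm.sub_right ((Commute.refl _).mul_right hb1.comm)
  have hbf' : p * b * f = p * b * (1 - p * b * (p * y)) := by
    rw [hf1, mul_sub, hpb, mul_sub, mul_one]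
  have hr : IsQuasinilpotent (p * b * f) := by
    rw [hbf']
    exact hb1.isQuasinilpotent_mul_one_sub
  have haff := ha.mul_of_commute (of_isIdempotentElem hff) haf
  have hcomm : Commute (p * b * f) (a * f) :=
    (hc.symm.mul_left haf.symm).mul_right (hbf.mul_left (Commute.refl f))
  obtain ⟨-, h1⟩ := haff.add_isQuasinilpotent hr hcomm
  have hcf : Commute (p * (a + b)) f := by
    rw [mul_add]
    exact ((show Commute p f from hpf.trans hfp.symm).mul_left haf).add_left hbf
  have h2 := hcc.mul_of_commute (of_isIdempotentElem hff) hcf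
  have h3 : p * (a + b) * f = p * b * f + a * f := by
    rw [mul_add, add_mul, mul_assoc p a, haf.eq, ← mul_assoc p f, hpf, add_comm]
  rw [h3] at h2
  -- Two inverses of p (a + b) f: as a commuting product, and as a f perturbed by the quasinilpotent
  -- p b f.
  have h4 := h2.unique h1
  have cp : c * p = c := by
    rw [← hcc.mul_mul_self', mul_assoc, mul_assoc]
    congr 2
    rw [mul_add, add_mul, hpb, mul_assoc, hap.eq, ← mul_assoc, hp.eq]
  rw [hf, ← mul_assoc, cp] at h4
  rw [h4, ← (hb.summable_specIdem_mul_neg_pow x).tsum_mul_left]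
  refine tsum_congr fun n => ?_
  have hb2 : p * (-b) * p = p * (-b) := by rw [mul_neg, neg_mul, hpb]
  have hbc : Commute (-b) (1 - b * y) := hb.commute_one_sub.neg_left
  have h5 : p * ((1 - b * y) * (-b) ^ n) = (p * (-b)) ^ n * f := by
    rw [← (hbc.pow_left n).eq, ← mul_assoc, mul_pow_eq_of_mul_mul_eq hb2, mul_assoc]
  have h6 : f * (-(p * b * f)) ^ n = (p * (-b)) ^ n * f := by
    have hbf2 : Commute (p * (-b)) f := by
      rw [mul_neg]
      exact hbf.neg_left
    rw [← neg_mul, ← mul_neg, hbf2.mul_pow, ← mul_assoc, ← (hbf2.pow_left n).eq, mul_assoc,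
      ← pow_succ', hff.pow_eq n.succ_ne_zero]
  have h7 : Commute (x ^ (n + 1)) ((p * (-b)) ^ n * f) := by
    refine Commute.pow_left (Commute.mul_right (Commute.pow_right ?_ n) hxf) _
    rw [mul_neg]
    exact hxb.neg_right
  rw [← hf, hxf.mul_pow, hff.pow_eq n.succ_ne_zero, mul_assoc, h6, h7.eq, ← h5]
  simp only [mul_assoc]

end IsGDrazinInverse

/-- If one of the corners of `b` is generalized Drazin invertible, then both are, and the
generalized Drazin inverse of `b` is triangular. -/
theorem IsGDrazinInverse.corners_of_or [CompleteSpace A] {p b y : A} (hp : IsIdempotentElem p)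
    (hb : IsGDrazinInverse b y) (hpb : p * b * p = p * b)
    (h : IsGDrazinInvertible (p * b) ∨ IsGDrazinInvertible (b * (1 - p))) :
    p * y * p = p * y ∧ IsGDrazinInverse (b * (1 - p)) (y * (1 - p)) := by
  have hqb := mul_mul_one_sub_eq hpb
  have hpy : p * y * p = p * y := by
    rcases h with ⟨z, hz⟩ | ⟨z, hz⟩
    · exact hb.mul_mul_eq_of_left hp hz hpb
    · exact mul_mul_eq_of_one_sub (hb.mul_mul_eq_of_right hp.one_sub hz hqb)
  exact ⟨hpy, hb.corner_right hqb (mul_mul_one_sub_eq hpy)⟩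

end GeneralizedDrazin

/-! ### The main theorem -/

theorem corollary2p5 {A : Type*} [NormedRing A] [NormedAlgebra ℂ A] [CompleteSpace A]
    (a b : A) (ha : IsGDrazinInvertible a) (hb : IsGDrazinInvertible b)
    (hab : a * b * specIdem a = specIdem a * b * a * specIdem a)
    (hcomm : a ^ 2 * aᵈ * b = a * aᵈ * b * a)
    (hcorner : IsGDrazinInvertible (specIdem a * b * specIdem a) ∨
      IsGDrazinInvertible (specIdem a * b) ∨
      IsGDrazinInvertible (b * specIdem a) ∨
      IsGDrazinInvertible (a * aᵈ * b * a * aᵈ) ∨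
      IsGDrazinInvertible (a * aᵈ * b) ∨
      IsGDrazinInvertible (b * a * aᵈ)) :
    List.TFAE [
      IsGDrazinInvertible (a + b),
      IsGDrazinInvertible (1 + aᵈ * b),
      IsGDrazinInvertible (a * aᵈ * (1 + aᵈ * b)),
      IsGDrazinInvertible ((1 + aᵈ * b) * a * aᵈ),
      IsGDrazinInvertible (a * aᵈ * (1 + aᵈ * b) * a * aᵈ)] ∧
    (IsGDrazinInvertible (a + b) → ∀ c : A, c = a * aᵈ * (a + b) →
      -- the element `c` and its generalized Drazin inverse
      IsGDrazinInvertible c ∧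
      Summable (fun n : ℕ => specIdem b * (-b) ^ n * aᵈ ^ (n + 1)) ∧
      cᵈ = aᵈ * (1 + aᵈ * b)ᵈ * b * bᵈ +
        a * aᵈ * ∑' n : ℕ, specIdem b * (-b) ^ n * aᵈ ^ (n + 1) ∧
      -- convergence of the series in the formula for the inverse of `a + b`
      Summable (fun n : ℕ => bᵈ ^ (n + 1) * (-a) ^ n * specIdem a) ∧
      Summable (fun n : ℕ => bᵈ ^ (n + 1) * (-a) ^ n * specIdem a * b * cᵈ) ∧
      Summable (fun n : ℕ =>
        (∑' k : ℕ, bᵈ ^ (k + 1) * (-a) ^ k * specIdem a) ^ (n + 2) *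
          b * a * aᵈ * c ^ n * specIdem c) ∧
      (∀ n : ℕ, Summable (fun k : ℕ => bᵈ ^ (k + 1) * (-a) ^ k * specIdem a *
          (a + b) ^ (n + 1) * specIdem a * b * cᵈ ^ (n + 2))) ∧
      Summable (fun n : ℕ =>
        (a + b) ^ n * specIdem a * b * cᵈ ^ (n + 2) -
          ∑' k : ℕ, bᵈ ^ (k + 1) * (-a) ^ k * specIdem a *
            (a + b) ^ (n + 1) * specIdem a * b * cᵈ ^ (n + 2)) ∧
      -- the formula itself
      (a + b)ᵈ = cᵈ
        + (∑' n : ℕ, bᵈ ^ (n + 1) * (-a) ^ n * specIdem a)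
        - (∑' n : ℕ, bᵈ ^ (n + 1) * (-a) ^ n * specIdem a * b * cᵈ)
        + (∑' n : ℕ, (∑' k : ℕ, bᵈ ^ (k + 1) * (-a) ^ k * specIdem a) ^ (n + 2) *
            b * a * aᵈ * c ^ n * specIdem c)
        + (∑' n : ℕ, ((a + b) ^ n * specIdem a * b * cᵈ ^ (n + 2) -
            ∑' k : ℕ, bᵈ ^ (k + 1) * (-a) ^ k * specIdem a *
              (a + b) ^ (n + 1) * specIdem a * b * cᵈ ^ (n + 2)))) := by
  have hA := ha.isGDrazinInverse
  have hB := hb.isGDrazinInverse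
  have hp := hA.isIdempotentElem
  have hpb := hA.mul_mul_eq_of_compat hab
  have hqb := mul_mul_one_sub_eq hpb
  have hc : Commute a (a * aᵈ * b) := by
    change _ = _
    rw [← hcomm]
    simp only [pow_two, mul_assoc]
  -- The six alternatives reduce to two by p b q = 0 and Cline's swap.
  have hor : IsGDrazinInvertible (a * aᵈ * b) ∨ IsGDrazinInvertible (b * (1 - a * aᵈ)) := by
    simp only [specIdem] at hcorner
    rcases hcorner with h | h | h | h | h | h
    · rw [hqb] at h
      exact Or.inr h
    · rw [isGDrazinInvertible_mul_comm, ← hp.one_sub.eq, ← mul_assoc,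
        isGDrazinInvertible_mul_comm, ← mul_assoc, hqb] at h
      exact Or.inr h
    · exact Or.inr h
    · rw [mul_assoc _ a, hpb] at h
      exact Or.inl h
    · exact Or.inl h
    · rw [mul_assoc, isGDrazinInvertible_mul_comm] at h
      exact Or.inl h
  obtain ⟨hpy, hbq⟩ := hB.corners_of_or hp hpb hor
  obtain ⟨hs2, hS⟩ := hA.corner_add hab hbq (mul_mul_one_sub_eq hpy)
  have hpw : a * aᵈ * (a + b) * (a * aᵈ) = a * aᵈ * (a + b) := by
    rw [mul_add, add_mul, hpb, mul_assoc (a * aᵈ), hA.commute_mul.eq, ← mul_assoc (a * aᵈ), hp.eq]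
  have h12 := isGDrazinInvertible_iff_corner hp hpw ⟨_, hS⟩
  have h23 := hA.isGDrazinInvertible_one_add_iff hpb
  have hcg : IsGDrazinInvertible (a * aᵈ * (a + b)) ↔
      IsGDrazinInvertible (a * aᵈ * (1 + aᵈ * b)) :=
    ⟨fun ⟨_, h⟩ => ⟨_, hA.one_add_of_corner_add hc h⟩,
      fun ⟨_, h⟩ => ⟨_, hA.corner_add_of_one_add hc h⟩⟩
  have e4 : (1 + aᵈ * b) * a * aᵈ = a * aᵈ * (1 + aᵈ * b) := by
    rw [mul_assoc, hA.one_add_mul hpb]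
  have e5 : a * aᵈ * (1 + aᵈ * b) * a * aᵈ = a * aᵈ * (1 + aᵈ * b) := by
    rw [mul_assoc _ a, mul_assoc (a * aᵈ), hA.one_add_mul hpb, ← mul_assoc, hp.eq]
  refine ⟨?_, ?_⟩
  · rw [e4, e5]
    tfae_have 1 ↔ 3 := h12.trans hcg
    tfae_have 2 ↔ 3 := h23
    tfae_have 3 ↔ 4 := Iff.rfl
    tfae_have 3 ↔ 5 := Iff.rfl
    tfae_finish
  intro hw c hcd
  have hci : IsGDrazinInvertible c := by
    rw [hcd]
    exact h12.1 hw
  have hC := hci.isGDrazinInverse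
  have hG : IsGDrazinInvertible (1 + aᵈ * b) := by
    rw [h23, ← hcg, ← hcd]
    exact hci
  have hcd' : cᵈ = aᵈ * (1 + aᵈ * b)ᵈ := by
    refine hC.unique ?_
    rw [hcd]
    exact hA.corner_add_of_isGDrazinInverse_one_add hpb hc hG.isGDrazinInverse
  have hC' : IsGDrazinInverse (a * aᵈ * (a + b)) cᵈ := by
    rw [← hcd]
    exact hC
  have hZ := hA.corner_add_mul_one_sub hB hpb hpy hc hC'
  obtain ⟨hs3, hs4, hF⟩ := IsGDrazinInverse.add_of_corners hp hA.commute_mul.symm hpb hcd hC hS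
  simp only [specIdem]
  have et : ∀ n : ℕ, ∑' k : ℕ, bᵈ ^ (k + 1) * (-a) ^ k * (1 - a * aᵈ) *
      (a + b) ^ (n + 1) * (1 - a * aᵈ) * b * cᵈ ^ (n + 2) =
      (∑' k : ℕ, bᵈ ^ (k + 1) * (-a) ^ k * (1 - a * aᵈ)) *
        ((a + b) ^ (n + 1) * (1 - a * aᵈ) * b * cᵈ ^ (n + 2)) := by
    intro n
    rw [← hs2.tsum_mul_right]
    simp only [mul_assoc]
  have et' : ∑' n : ℕ, bᵈ ^ (n + 1) * (-a) ^ n * (1 - a * aᵈ) * b * cᵈ =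
      (∑' k : ℕ, bᵈ ^ (k + 1) * (-a) ^ k * (1 - a * aᵈ)) * (b * cᵈ) := by
    rw [← hs2.tsum_mul_right]
    simp only [mul_assoc]
  simp only [et, et']
  have hba : ∀ s : A, ∀ n : ℕ, s ^ (n + 2) * b * a * aᵈ = s ^ (n + 2) * b * (a * aᵈ) :=
    fun s n => mul_assoc _ _ _
  simp only [hba]
  refine ⟨hci, hB.summable_specIdem_mul_neg_pow _, ?_, hs2, ?_, hs3, fun n => ?_, hs4,
    hF.gDrazinInv_eq⟩
  -- The formula is c^d = c^d b b^d + c^d b^π, with each summand already computed.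
  · rw [← hcd', ← hZ, mul_assoc, ← mul_add, add_sub_cancel, mul_one]
  · exact (hs2.mul_right (b * cᵈ)).congr fun n => by simp only [mul_assoc]
  · exact (hs2.mul_right ((a + b) ^ (n + 1) * (1 - a * aᵈ) * b * cᵈ ^ (n + 2))).congr
      fun k => by simp only [mul_assoc]
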